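/- Let $\mathbb Z^2$ be the square lattice graph (edges join vertices at $\ell^1$-distance $1$), and for $N\in\mathbb N$ let $[N]^2$ be its induced subgraph on $\{0,\dots,N-1\}^2$; let $\partial[N]^2$ be the set of vertices of $[N]^2$ having a lattice neighbour outside $[N]^2$. A lattice forest is an acyclic subgraph $F$ of $\mathbb Z^2$ (not necessarily containing all vertices of $\mathbb Z^2$); it is *single-infinite* if each of its connected components is an infinite tree that does not contain two vertex-disjoint one-way infinite simple paths. A *bridge* of $F$ in $[N]^2$ is a simple path, with at least one edge, in $F\cap[N]^2$ whose two endpoints belong to $\partial[N]^2$. There is a universal constant $C'>0$ such that the following holds for every translation-invariant probability measure $\eta$ on subgraphs of $\mathbb Z^2$ (with the product $\sigma$-algebra) under which $F$ is almost surely a single-infinite lattice forest, and for every $N\in\mathbb N$ (with $N\log N:=0$ for $N=0$). 1. (Vertices) For every vertex $v$ of $\mathbb Z^2$, $$\mathbb E_\eta\big[\#\{\text{vertices of } F \text{ lying on bridges of } F \text{ in } [N]^2\}\big]\;\ge\; C'\,\mathbb P_\eta(v\in V(F))\,N\log N .$$ 2. (Edges) For every edge $e$ of $\mathbb Z^2$,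 $$\mathbb E_\eta\big[\#\{\text{edges of } F \text{ lying on bridges of } F \text{ in } [N]^2\}\big]\;\ge\; C'\,\mathbb P_\eta(e\in E(F))\,N\log N .$$ In particular, if $p_\eta$ denotes the probability that a vertex (respectively, an edge) belongs to the forest, the bound $CN\log N$ holds with $C=C'p_\eta$, which is positive as soon as $p_\eta>0$. -/

import Mathlib

open MeasureTheory

/-- The square lattice `ℤ²`: two vertices are adjacent when their `ℓ¹` distance is `1`. -/
def squareLattice : SimpleGraph (ℤ × ℤ) where
  Adj u v := |u.1 - v.1| + |u.2 - v.2| = 1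
  symm := ⟨fun u v h => by rw [abs_sub_comm v.1, abs_sub_comm v.2]; exact h⟩
  loopless := ⟨fun u h => by simp at h⟩

/-- Subgraphs of the square lattice (a vertex set together with a set of lattice edges). -/
abbrev LatticeSubgraph := squareLattice.Subgraph

/-- The product (cylinder) σ-algebra on subgraphs of the lattice: the one generated by the
events "`v` is a vertex of `F`" and "`u v` is an edge of `F`". -/
instance LatticeSubgraph.instMeasurableSpace : MeasurableSpace LatticeSubgraph :=
  MeasurableSpace.comap
    (fun F : LatticeSubgraph =>
      ((fun v => v ∈ F.verts, fun u v => F.Adj u v) :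
        (ℤ × ℤ → Prop) × (ℤ × ℤ → ℤ × ℤ → Prop)))
    inferInstance

/-- The subgraph `F + a`. -/
def LatticeSubgraph.translate (a : ℤ × ℤ) (F : LatticeSubgraph) : LatticeSubgraph where
  verts := {v | v - a ∈ F.verts}
  Adj u v := F.Adj (u - a) (v - a)
  adj_sub {u v} h := by
    have h' := F.adj_sub h
    simpa [squareLattice] using h'
  edge_vert h := F.edge_vert h
  symm := ⟨fun _ _ h => F.symm.symm _ _ h⟩

/-- `η` is invariant under all translations of the lattice. -/
def IsTranslationInvariant (η : Measure LatticeSubgraph) : Prop :=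
  ∀ a : ℤ × ℤ, MeasurePreserving (LatticeSubgraph.translate a) η η

/-- A one-way infinite simple path in a graph. -/
def IsOneWayInfinitePath {V : Type*} (G : SimpleGraph V) (r : ℕ → V) : Prop :=
  Function.Injective r ∧ ∀ n, G.Adj (r n) (r (n + 1))

/-- An infinite tree which does not contain two disjoint one-way infinite simple paths. -/
def IsSingleInfiniteTree {V : Type*} (T : SimpleGraph V) : Prop :=
  T.IsTree ∧ Infinite V ∧
    ¬ ∃ r s : ℕ → V, IsOneWayInfinitePath T r ∧ IsOneWayInfinitePath T s ∧
      Disjoint (Set.range r) (Set.range s)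

/-- A lattice forest all of whose components are single-infinite trees. -/
def IsSingleInfiniteForest (F : LatticeSubgraph) : Prop :=
  F.coe.IsAcyclic ∧ ∀ c : F.coe.ConnectedComponent, IsSingleInfiniteTree c.toSimpleGraph

/-- The vertex set `{0, …, N - 1}²` of the box `[N]²`. -/
def boxVerts (N : ℕ) : Set (ℤ × ℤ) :=
  {v | (0 ≤ v.1 ∧ v.1 < N) ∧ (0 ≤ v.2 ∧ v.2 < N)}

/-- The box `[N]²`, as an induced subgraph of the lattice. -/
def box (N : ℕ) : LatticeSubgraph := (⊤ : LatticeSubgraph).induce (boxVerts N)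

/-- The vertices of `∂[N]²`: those vertices of the box with a lattice neighbour outside it. -/
def boxBoundary (N : ℕ) : Set (ℤ × ℤ) :=
  {v | v ∈ boxVerts N ∧ ∃ w, squareLattice.Adj v w ∧ w ∉ boxVerts N}

/-- A bridge of `F` in `[N]²`: a simple path (with at least one edge) in `F ∩ [N]²` whose
endpoints belong to `∂[N]²`. -/
def IsBridge (F : LatticeSubgraph) (N : ℕ) {u v : ℤ × ℤ} (p : squareLattice.Walk u v) : Prop :=
  p.IsPath ∧ 0 < p.length ∧ p.toSubgraph ≤ F ⊓ box N ∧ u ∈ boxBoundary N ∧ v ∈ boxBoundary N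

/-- The vertices which lie on bridges. -/
def bridgeVertices (F : LatticeSubgraph) (N : ℕ) : Set (ℤ × ℤ) :=
  {x | ∃ (u v : ℤ × ℤ) (p : squareLattice.Walk u v), IsBridge F N p ∧ x ∈ p.support}

/-- The edges which lie on bridges. -/
def bridgeEdges (F : LatticeSubgraph) (N : ℕ) : Set (Sym2 (ℤ × ℤ)) :=
  {e | ∃ (u v : ℤ × ℤ) (p : squareLattice.Walk u v), IsBridge F N p ∧ e ∈ p.edges}

/-! Let `p` be the probability that a vertex belongs to `F`. From a vertex of `F`, a path of the
infinite component runs arbitrarily far, so it crosses the sup-norm sphere of radius `k` about its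
start. The crossing point lies on one of four sides of `2k + 1` points each. A union bound and
translation invariance then give `p ≤ (2k + 1) ∑_d P(longPathEvent d k R 0)`
(`measureReal_mem_verts_le_sum`): a fixed vertex lies on such a path with total probability at least
`p / (2k + 1)`.

Apply this with `R = N` to a vertex at depth `k` behind a side of the box. The path starts on the
line carrying that side and ends outside the box, so its portion around the vertex contains a bridge
(`boxPoint_mem_bridgeVertices`). For each `d` and `k` there are `N - 2` such vertices; summing over
`k` produces a harmonic sum, hence `N log N`.

The edge bound follows from the vertex bound: a bridge edge has only two endpoints, and an edge of
`F` forces its endpoints into `F`. -/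

namespace LatticeSubgraph

open SimpleGraph hiding IsBridge

/-! ### Measurability of path events -/

lemma measurable_verts_adj : Measurable (fun F : LatticeSubgraph =>
    ((fun v => v ∈ F.verts, fun u v => F.Adj u v) :
      (ℤ × ℤ → Prop) × (ℤ × ℤ → ℤ × ℤ → Prop))) := comap_measurable _

lemma measurableSet_mem_verts (v : ℤ × ℤ) :
    MeasurableSet {F : LatticeSubgraph | v ∈ F.verts} :=
  measurableSet_setOfPred.2 ((measurable_pi_apply v).comp measurable_verts_adj.fst)

lemma measurableSet_adj (u v : ℤ × ℤ) : MeasurableSet {F : LatticeSubgraph | F.Adj u v} :=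
  measurableSet_setOfPred.2
    ((measurable_pi_apply v).comp ((measurable_pi_apply u).comp measurable_verts_adj.snd))

lemma measurableSet_le (H : LatticeSubgraph) : MeasurableSet {F : LatticeSubgraph | H ≤ F} := by
  have : {F : LatticeSubgraph | H ≤ F} =
      (⋂ v ∈ H.verts, {F | v ∈ F.verts}) ∩ ⋂ u, ⋂ v, ⋂ _ : H.Adj u v, {F | F.Adj u v} := by
    ext F
    simp only [Set.mem_ofPred_eq, Set.mem_inter_iff, Set.mem_iInter]
    exact ⟨fun h => ⟨fun v hv => h.1 hv, fun u v huv => h.2 huv⟩,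
      fun h => ⟨fun v hv => h.1 v hv, fun u v huv => h.2 u v huv⟩⟩
  rw [this]
  refine (MeasurableSet.biInter (Set.to_countable _) fun v _ => measurableSet_mem_verts v).inter ?_
  exact MeasurableSet.iInter fun u => .iInter fun v => .iInter fun _ => measurableSet_adj u v

/-- This makes path events countable unions of cylinder events. -/
instance countable_walk (u v : ℤ × ℤ) : Countable (squareLattice.Walk u v) :=
  Function.Injective.countable (f := fun p => p.support) fun _ _ h => Walk.ext_support h

lemma measurableSet_mem_bridgeVertices (N : ℕ) (x : ℤ × ℤ) :
    MeasurableSet {F : LatticeSubgraph | x ∈ bridgeVertices F N} := by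
  have : {F : LatticeSubgraph | x ∈ bridgeVertices F N} =
      ⋃ u, ⋃ v, ⋃ p : squareLattice.Walk u v,
        {F | p.toSubgraph ≤ F} ∩ {_F | p.IsPath ∧ 0 < p.length ∧ p.toSubgraph ≤ box N ∧
          u ∈ boxBoundary N ∧ v ∈ boxBoundary N ∧ x ∈ p.support} := by
    ext F
    simp only [bridgeVertices, IsBridge, le_inf_iff, Set.mem_ofPred_eq, Set.mem_iUnion,
      Set.mem_inter_iff]
    refine exists_congr fun u => exists_congr fun v => exists_congr fun p => ?_
    tauto
  rw [this]
  exact .iUnion fun u => .iUnion fun v => .iUnion fun p =>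
    (measurableSet_le _).inter (MeasurableSet.const _)

lemma measurableSet_mem_bridgeEdges (N : ℕ) (e : Sym2 (ℤ × ℤ)) :
    MeasurableSet {F : LatticeSubgraph | e ∈ bridgeEdges F N} := by
  have : {F : LatticeSubgraph | e ∈ bridgeEdges F N} =
      ⋃ u, ⋃ v, ⋃ p : squareLattice.Walk u v,
        {F | p.toSubgraph ≤ F} ∩ {_F | p.IsPath ∧ 0 < p.length ∧ p.toSubgraph ≤ box N ∧
          u ∈ boxBoundary N ∧ v ∈ boxBoundary N ∧ e ∈ p.edges} := by
    ext F
    simp only [bridgeEdges, IsBridge, le_inf_iff, Set.mem_ofPred_eq, Set.mem_iUnion,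
      Set.mem_inter_iff]
    refine exists_congr fun u => exists_congr fun v => exists_congr fun p => ?_
    tauto
  rw [this]
  exact .iUnion fun u => .iUnion fun v => .iUnion fun p =>
    (measurableSet_le _).inter (MeasurableSet.const _)

/-! ### Geometry of the box -/

/-- The vertices of the box, as a finite set. -/
noncomputable def boxFinset (N : ℕ) : Finset (ℤ × ℤ) := Finset.Ico 0 (N : ℤ) ×ˢ Finset.Ico 0 (N : ℤ)

lemma mem_boxFinset {N : ℕ} {v : ℤ × ℤ} : v ∈ boxFinset N ↔ v ∈ boxVerts N := by
  simp [boxFinset, boxVerts]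

lemma bridgeVertices_subset (F : LatticeSubgraph) (N : ℕ) :
    bridgeVertices F N ⊆ boxFinset N := by
  rintro x ⟨u, v, p, hp, hx⟩
  exact mem_boxFinset.2 (hp.2.2.1.1 ((Walk.mem_verts_toSubgraph p).2 hx)).2

lemma bridgeEdges_subset (F : LatticeSubgraph) (N : ℕ) :
    bridgeEdges F N ⊆ (boxFinset N).sym2 := by
  rintro e ⟨u, v, p, hp, he⟩
  refine Finset.mem_coe.2 (Finset.mem_sym2_iff.2 fun a ha => ?_)
  have hx : a ∈ p.support := by
    induction e with
    | _ b c =>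
      rcases Sym2.mem_iff.1 ha with rfl | rfl
      · exact p.fst_mem_support_of_mem_edges he
      · exact p.snd_mem_support_of_mem_edges he
  exact bridgeVertices_subset F N ⟨u, v, p, hp, hx⟩

lemma exists_mem_edges_of_mem_support {V : Type*} {G : SimpleGraph V} {u v x : V} (p : G.Walk u v)
    (hp : 0 < p.length) (hx : x ∈ p.support) : ∃ e ∈ p.edges, x ∈ e := by
  induction p with
  | nil => simp at hp
  | cons h q ih =>
    rcases List.mem_cons.1 hx with rfl | hx'
    · exact ⟨_, List.mem_cons_self, Sym2.mem_mk_left _ _⟩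
    · rcases Nat.eq_zero_or_pos q.length with h0 | h0
      · obtain rfl := Walk.eq_of_length_eq_zero h0
        obtain rfl : x = _ := by simpa [Walk.nil_iff_support_eq.1 (Walk.length_eq_zero_iff.1 h0)] using hx'
        exact ⟨_, List.mem_cons_self, Sym2.mem_mk_right _ _⟩
      · obtain ⟨e, he, hxe⟩ := ih h0 hx'
        exact ⟨e, List.mem_cons_of_mem _ he, hxe⟩

/-- A bridge has positive length, so each of its vertices is an endpoint of one of its edges. -/
lemma ncard_bridgeVertices_le (F : LatticeSubgraph) (N : ℕ) :
    (bridgeVertices F N).ncard ≤ 2 * (bridgeEdges F N).ncard := by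
  classical
  have hfin : (bridgeEdges F N).Finite := (Finset.finite_toSet _).subset (bridgeEdges_subset F N)
  have hsub : bridgeVertices F N ⊆ (hfin.toFinset.biUnion Sym2.toFinset : Finset (ℤ × ℤ)) := by
    rintro x ⟨u, v, p, hp, hx⟩
    obtain ⟨e, he, hxe⟩ := exists_mem_edges_of_mem_support p hp.2.1 hx
    simp only [Finset.coe_biUnion, Set.mem_iUnion]
    exact ⟨e, hfin.mem_toFinset.2 ⟨u, v, p, hp, he⟩, by simpa using hxe⟩
  calc (bridgeVertices F N).ncard ≤ (hfin.toFinset.biUnion Sym2.toFinset).card := by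
        rw [← Set.ncard_coe_finset]
        exact Set.ncard_le_ncard hsub (Finset.finite_toSet _)
    _ ≤ hfin.toFinset.card * 2 := Finset.card_biUnion_le_card_mul _ _ _ fun e _ => by
        rw [Sym2.card_toFinset]
        split_ifs <;> norm_num
    _ = 2 * (bridgeEdges F N).ncard := by
        rw [Set.ncard_eq_toFinset_card _ hfin, mul_comm]

/-- All neighbours of an interior vertex are in the box, so a walk cannot leave the interior without
stepping on the boundary; cut at the first such step. -/
lemma exists_prefix_to_boundary {N : ℕ} {v w : ℤ × ℤ} (p : squareLattice.Walk v w)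
    (hv : v ∈ boxVerts N \ boxBoundary N) (hw : w ∉ boxVerts N \ boxBoundary N) :
    ∃ b ∈ boxBoundary N, ∃ (q : squareLattice.Walk v b) (r : squareLattice.Walk b w),
      p = q.append r ∧ ∀ x ∈ q.support, x ∈ boxVerts N := by
  induction p with
  | nil => exact absurd hv hw
  | @cons v v' w h p ih =>
    have hv' : v' ∈ boxVerts N := by
      by_contra hc
      exact hv.2 ⟨hv.1, v', h, hc⟩
    by_cases hb : v' ∈ boxBoundary N
    · refine ⟨v', hb, .cons h .nil, p, by simp, ?_⟩
      intro x hx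
      simp only [Walk.support_cons, Walk.support_nil, List.mem_cons, List.not_mem_nil,
        or_false] at hx
      rcases hx with rfl | rfl
      exacts [hv.1, hv']
    · obtain ⟨b, hb, q, r, hqr, hq⟩ := ih ⟨hv', hb⟩ hw
      refine ⟨b, hb, .cons h q, r, by simp [hqr], ?_⟩
      intro x hx
      rcases List.mem_cons.1 hx with rfl | hx
      exacts [hv.1, hq x hx]

lemma toSubgraph_le_box {N : ℕ} {u v : ℤ × ℤ} (p : squareLattice.Walk u v)
    (hp : ∀ x ∈ p.support, x ∈ boxVerts N) : p.toSubgraph ≤ box N :=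
  p.toSubgraph_le_induce_support.trans (Subgraph.induce_mono_right hp)

/-- A path of `F` which visits an interior vertex of the box, and whose endpoints are not
interior, contains a bridge through that vertex. -/
lemma mem_bridgeVertices_of_isPath {F : LatticeSubgraph} {N : ℕ} {u v w : ℤ × ℤ}
    (p : squareLattice.Walk w u) (hp : p.IsPath) (hF : p.toSubgraph ≤ F) (hvp : v ∈ p.support)
    (hv : v ∈ boxVerts N \ boxBoundary N) (hw : w ∉ boxVerts N \ boxBoundary N)
    (hu : u ∉ boxVerts N \ boxBoundary N) : v ∈ bridgeVertices F N := by
  classical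
  obtain ⟨b, hb, q, r, hqr, hq⟩ := exists_prefix_to_boundary (p.takeUntil v hvp).reverse hv hw
  obtain ⟨b', hb', q', r', hqr', hq'⟩ := exists_prefix_to_boundary (p.dropUntil v hvp) hv hu
  -- The bridge is the middle piece: from `v`, walk both backwards and forwards along `p` until the
  -- boundary is first met.
  have hp' : p = (r.reverse.append (q.reverse.append q')).append r' := by
    rw [← p.take_spec hvp, hqr', ← (p.takeUntil v hvp).reverse_reverse, hqr, Walk.reverse_append]
    simp only [Walk.append_assoc]
  rw [hp'] at hp hF
  have hpath : (q.reverse.append q').IsPath := hp.of_append_left.of_append_right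
  simp only [Walk.toSubgraph_append, sup_le_iff] at hF
  refine ⟨b, b', q.reverse.append q', ⟨hpath, ?_, le_inf ?_ (toSubgraph_le_box _ ?_), hb, hb'⟩, ?_⟩
  · rw [Walk.length_append]
    refine Nat.add_pos_left (Nat.pos_of_ne_zero fun h0 => hv.2 ?_) _
    rw [← Walk.eq_of_length_eq_zero h0]
    exact hb
  · rw [Walk.toSubgraph_append]
    exact sup_le hF.1.2.1 hF.1.2.2
  · intro x hx
    rcases Walk.mem_support_append_iff _ _ |>.1 hx with hx | hx
    · exact hq x (by simpa using hx)
    · exact hq' x hx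
  · exact Walk.mem_support_append_iff _ _ |>.2 (.inr q'.start_mem_support)

/-! ### Long paths in subgraphs with infinite components -/

lemma toSubgraph_map_hom_le {V : Type*} {G : SimpleGraph V} (F : G.Subgraph) {a b : F.verts}
    (p : F.coe.Walk a b) : (p.map F.hom).toSubgraph ≤ F := by
  induction p with
  | nil => simp
  | cons h q ih =>
    refine sup_le (G.subgraphOfAdj_le_of_adj F h) ih

/-- Discrete intermediate value property: `f` increases by at most one per step. -/
lemma exists_mem_support_eq {k : ℤ} (f : ℤ × ℤ → ℤ)
    (hf : ∀ x y, squareLattice.Adj x y → f y ≤ f x + 1) {u v : ℤ × ℤ}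
    (p : squareLattice.Walk u v) (hu : f u ≤ k) (hv : k ≤ f v) : ∃ x ∈ p.support, f x = k := by
  induction p with
  | nil => exact ⟨_, by simp, le_antisymm hu hv⟩
  | @cons u u' v h p ih =>
    rcases hu.eq_or_lt with hu | hu
    · exact ⟨u, by simp, hu⟩
    · obtain ⟨x, hx, hxk⟩ := ih (by have := hf _ _ h; omega) hv
      exact ⟨x, List.mem_cons_of_mem _ hx, hxk⟩

/-- Every vertex of a forest with infinite components starts arbitrarily long paths. -/
lemma exists_isPath_of_isSingleInfiniteForest {F : LatticeSubgraph} (hF : IsSingleInfiniteForest F)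
    {w : ℤ × ℤ} (hw : w ∈ F.verts) (R : ℤ) :
    ∃ (u : ℤ × ℤ) (p : squareLattice.Walk w u), p.IsPath ∧ p.toSubgraph ≤ F ∧
      R ≤ max |u.1 - w.1| |u.2 - w.2| := by
  classical
  set c := F.coe.connectedComponentMk ⟨w, hw⟩
  have hinf : Infinite c.supp := (hF.2 c).2.1
  -- An infinite component cannot fit in this finite square.
  let B : Finset (ℤ × ℤ) := Finset.Icc (w.1 - R) (w.1 + R) ×ˢ Finset.Icc (w.2 - R) (w.2 + R)
  obtain ⟨x, hx⟩ : ∃ x : c.supp, (x : F.verts).1 ∉ B := by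
    by_contra! hc
    have hinj : Function.Injective fun x : c.supp => (⟨(x : F.verts).1, hc x⟩ : B) :=
      fun x y hxy => Subtype.ext (Subtype.ext (congrArg (fun z : B => z.1) hxy))
    exact not_finite_iff_infinite.2 hinf (Finite.of_injective _ hinj)
  have hr : F.coe.Reachable ⟨w, hw⟩ x.1 := (ConnectedComponent.exact x.2).symm
  obtain ⟨p⟩ := hr
  refine ⟨_, p.toPath.1.map F.hom, ?_, toSubgraph_map_hom_le F _, ?_⟩
  · exact p.toPath.2.map F.hom_injective
  · by_contra! hlt
    apply hx
    rw [max_lt_iff, abs_lt, abs_lt] at hlt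
    simp only [Subgraph.hom_apply] at hlt
    simp only [B, Finset.mem_product, Finset.mem_Icc]
    omega


/-! ### The event that a vertex lies on a long path -/

/-- One of the four signed coordinates of a lattice point. -/
def signedCoord (d : Bool × Bool) (x : ℤ × ℤ) : ℤ :=
  bif d.1 then (bif d.2 then x.1 else -x.1) else (bif d.2 then x.2 else -x.2)

/-- The lattice point whose signed coordinate is `k` and whose other coordinate is `t`. -/
def ofSignedCoord (d : Bool × Bool) (k t : ℤ) : ℤ × ℤ :=
  bif d.1 then (bif d.2 then k else -k, t) else (t, bif d.2 then k else -k)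

/-- The event that `v` lies on a path of `F` which starts `k` steps behind `v` in direction `d` and
ends at distance at least `R` from `v`. -/
def longPathEvent (d : Bool × Bool) (k R : ℤ) (v : ℤ × ℤ) : Set LatticeSubgraph :=
  {F | ∃ (w u : ℤ × ℤ) (p : squareLattice.Walk w u), p.toSubgraph ≤ F ∧ p.IsPath ∧ v ∈ p.support ∧
    signedCoord d v - signedCoord d w = k ∧ R ≤ max |u.1 - v.1| |u.2 - v.2|}

lemma measurableSet_longPathEvent (d : Bool × Bool) (k R : ℤ) (v : ℤ × ℤ) :
    MeasurableSet (longPathEvent d k R v) := by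
  have : longPathEvent d k R v = ⋃ w, ⋃ u, ⋃ p : squareLattice.Walk w u,
      {F | p.toSubgraph ≤ F} ∩ {_F | p.IsPath ∧ v ∈ p.support ∧
        signedCoord d v - signedCoord d w = k ∧ R ≤ max |u.1 - v.1| |u.2 - v.2|} := by
    ext F
    simp only [longPathEvent, Set.mem_ofPred_eq, Set.mem_iUnion, Set.mem_inter_iff]
  rw [this]
  exact .iUnion fun u => .iUnion fun v => .iUnion fun p =>
    (measurableSet_le _).inter (MeasurableSet.const _)

/-- Translation by `a` as a homomorphism of the lattice. -/
def shiftHom (a : ℤ × ℤ) : squareLattice →g squareLattice where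
  toFun x := x + a
  map_rel' {x y} h := by simpa [squareLattice] using h

lemma translate_mem_longPathEvent {d : Bool × Bool} {k R : ℤ} {v : ℤ × ℤ} (a : ℤ × ℤ)
    {F : LatticeSubgraph} (hF : F ∈ longPathEvent d k R v) :
    translate a F ∈ longPathEvent d k R (v + a) := by
  obtain ⟨w, u, p, hpF, hp, hv, hk, hR⟩ := hF
  refine ⟨shiftHom a w, shiftHom a u, p.map (shiftHom a), ?_, hp.map (add_left_injective a), ?_, ?_, ?_⟩
  · rw [Walk.toSubgraph_map]
    constructor
    · rintro _ ⟨x, hx, rfl⟩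
      simpa [translate, shiftHom] using hpF.1 hx
    · rintro _ _ ⟨x, y, hxy, rfl, rfl⟩
      simpa [translate, shiftHom] using hpF.2 hxy
  · rw [Walk.support_map]
    exact List.mem_map_of_mem (f := shiftHom a) hv
  · rw [← hk]
    rcases d with ⟨_ | _, _ | _⟩ <;> simp [signedCoord, shiftHom]
  · simpa [shiftHom] using hR

lemma measureReal_longPathEvent_le {η : Measure LatticeSubgraph} [IsProbabilityMeasure η]
    (hη : IsTranslationInvariant η) (d : Bool × Bool) (k R : ℤ) (v w : ℤ × ℤ) :
    η.real (longPathEvent d k R v) ≤ η.real (longPathEvent d k R w) := by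
  rw [← (hη (w - v)).measureReal_preimage
    (measurableSet_longPathEvent d k R w).nullMeasurableSet]
  refine measureReal_mono fun F hF => ?_
  have := translate_mem_longPathEvent (w - v) hF
  rwa [add_sub_cancel] at this

lemma measureReal_mem_verts_le_of_invariant {η : Measure LatticeSubgraph} [IsProbabilityMeasure η]
    (hη : IsTranslationInvariant η) (v w : ℤ × ℤ) :
    η.real {F | v ∈ F.verts} ≤ η.real {F | w ∈ F.verts} := by
  rw [← (hη (w - v)).measureReal_preimage (measurableSet_mem_verts w).nullMeasurableSet]
  refine measureReal_mono fun F hF => ?_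
  simpa [translate] using hF

lemma measureReal_adj_le_of_invariant {η : Measure LatticeSubgraph} [IsProbabilityMeasure η]
    (hη : IsTranslationInvariant η) (v w a : ℤ × ℤ) :
    η.real {F | F.Adj v w} ≤ η.real {F | F.Adj (v + a) (w + a)} := by
  rw [← (hη a).measureReal_preimage (measurableSet_adj (v + a) (w + a)).nullMeasurableSet]
  refine measureReal_mono fun F hF => ?_
  simpa [translate] using hF

/-- The path from the origin is observed where it meets the sphere of radius `k`; `d` records the
side that is hit and `t` the position on it. -/
lemma exists_mem_longPathEvent {F : LatticeSubgraph} (hF : IsSingleInfiniteForest F)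
    (h0 : (0 : ℤ × ℤ) ∈ F.verts) {k : ℤ} (hk : 0 ≤ k) {R : ℤ} (hR : 0 ≤ R) :
    ∃ d, ∃ t ∈ Finset.Icc (-k) k, F ∈ longPathEvent d k R (ofSignedCoord d k t) := by
  -- Going as far as `k + R` leaves distance at least `R` from the crossing point, by the triangle
  -- inequality.
  obtain ⟨u, p, hp, hpF, hu⟩ := exists_isPath_of_isSingleInfiniteForest hF h0 (k + R)
  simp only [Prod.fst_zero, Prod.snd_zero, sub_zero] at hu
  obtain ⟨v, hv, hvk⟩ := exists_mem_support_eq (k := k) (fun x => max |x.1| |x.2|)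
    (fun x y h => by
      have h' : |x.1 - y.1| + |x.2 - y.2| = 1 := h
      grind) p (by simpa using hk) (by omega)
  have hfar : R ≤ max |u.1 - v.1| |u.2 - v.2| := by grind
  have key : ∀ d t, v = ofSignedCoord d k t → |t| ≤ k →
      ∃ d, ∃ t ∈ Finset.Icc (-k) k, F ∈ longPathEvent d k R (ofSignedCoord d k t) := by
    intro d t hdt ht
    refine ⟨d, t, Finset.mem_Icc.2 (abs_le.1 ht), 0, u, p, hpF, hp, hdt ▸ hv, ?_, hdt ▸ hfar⟩
    rcases d with ⟨_ | _, _ | _⟩ <;> simp [signedCoord, ofSignedCoord]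
  have h1 : |v.1| ≤ k := hvk ▸ le_max_left _ _
  have h2 : |v.2| ≤ k := hvk ▸ le_max_right _ _
  have h3 : v.1 = k ∨ v.1 = -k ∨ v.2 = k ∨ v.2 = -k := by grind
  rcases h3 with h | h | h | h
  · exact key (true, true) v.2 (by ext <;> simp [ofSignedCoord, h]) h2
  · exact key (true, false) v.2 (by ext <;> simp [ofSignedCoord, h]) h2
  · exact key (false, true) v.1 (by ext <;> simp [ofSignedCoord, h]) h1
  · exact key (false, false) v.1 (by ext <;> simp [ofSignedCoord, h]) h1

lemma measureReal_mem_verts_le_sum {η : Measure LatticeSubgraph} [IsProbabilityMeasure η]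
    (hη : IsTranslationInvariant η) (hF : ∀ᵐ F ∂η, IsSingleInfiniteForest F)
    (k : ℕ) {R : ℤ} (hR : 0 ≤ R) :
    η.real {F | 0 ∈ F.verts} ≤
      (2 * k + 1) * ∑ d : Bool × Bool, η.real (longPathEvent d k R 0) := by
  calc η.real {F | 0 ∈ F.verts}
      ≤ η.real (⋃ d ∈ (Finset.univ : Finset (Bool × Bool)), ⋃ t ∈ Finset.Icc (-k : ℤ) k,
          longPathEvent d k R (ofSignedCoord d k t)) := by
        refine ENNReal.toReal_mono (measure_ne_top _ _) (measure_mono_ae ?_)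
        filter_upwards [hF] with F hF h0
        obtain ⟨d, t, ht, h⟩ := exists_mem_longPathEvent hF h0 (Int.natCast_nonneg k) hR
        exact Set.mem_biUnion (Finset.mem_univ d) (Set.mem_biUnion ht h)
    _ ≤ ∑ d : Bool × Bool, η.real (⋃ t ∈ Finset.Icc (-k : ℤ) k,
          longPathEvent d k R (ofSignedCoord d k t)) := measureReal_biUnion_finset_le _ _
    _ ≤ ∑ d : Bool × Bool, (2 * k + 1) * η.real (longPathEvent d k R 0) := by
        refine Finset.sum_le_sum fun d _ => (measureReal_biUnion_finset_le _ _).trans ?_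
        refine (Finset.sum_le_card_nsmul _ _ _ fun t _ =>
          measureReal_longPathEvent_le hη d k R _ 0).trans_eq ?_
        have hc : (Finset.Icc (-k : ℤ) k).card = 2 * k + 1 := by
          rw [Int.card_Icc]; omega
        rw [hc, nsmul_eq_mul]
        push_cast
        ring
    _ = _ := by rw [Finset.mul_sum]

/-! ### Counting vertices on bridges -/

lemma ncard_eq_sum_indicator {α : Type*} (s : Finset α) {t : Set α} (h : t ⊆ s) :
    (t.ncard : ℝ) = ∑ x ∈ s, Set.indicator t (fun _ => (1 : ℝ)) x := by
  classical
  have ht : t = (s.filter (· ∈ t) : Finset α) := by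
    ext x
    simpa using fun hx => h hx
  simp only [Set.indicator_apply]
  rw [Finset.sum_boole]
  conv_lhs => rw [ht, Set.ncard_coe_finset]

lemma integrable_ncard_and_integral_eq {Ω α : Type*} [MeasurableSpace Ω] {μ : Measure Ω}
    [IsFiniteMeasure μ] (s : Finset α) (t : Ω → Set α) (h : ∀ ω, t ω ⊆ s)
    (hm : ∀ x, MeasurableSet {ω | x ∈ t ω}) :
    Integrable (fun ω => ((t ω).ncard : ℝ)) μ ∧
      ∫ ω, ((t ω).ncard : ℝ) ∂μ = ∑ x ∈ s, μ.real {ω | x ∈ t ω} := by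
  have heq : (fun ω => ((t ω).ncard : ℝ)) =
      fun ω => ∑ x ∈ s, Set.indicator {ω | x ∈ t ω} (fun _ => (1 : ℝ)) ω := by
    funext ω
    rw [ncard_eq_sum_indicator s (h ω)]
    rfl
  have hint : ∀ x ∈ s, Integrable (Set.indicator {ω | x ∈ t ω} (fun _ => (1 : ℝ))) μ :=
    fun x _ => (integrable_const _).indicator (hm x)
  rw [heq]
  refine ⟨integrable_finsetSum _ hint, ?_⟩
  rw [integral_finsetSum _ hint]
  exact Finset.sum_congr rfl fun x _ => integral_indicator_one (hm x)

/-- The point of the box at distance `k` from the side opposite to the direction `d`, with other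
coordinate `j`. -/
def boxPoint (N : ℕ) (d : Bool × Bool) (x : ℕ × ℕ) : ℤ × ℤ :=
  ofSignedCoord d (bif d.2 then x.1 else x.1 + 1 - N) x.2

lemma boxPoint_injective (N : ℕ) (d : Bool × Bool) : Function.Injective (boxPoint N d) := by
  rintro ⟨a, b⟩ ⟨a', b'⟩ h
  rcases d with ⟨_ | _, _ | _⟩ <;>
    simp only [boxPoint, ofSignedCoord, cond_true, cond_false, Prod.mk.injEq] at h ⊢ <;> omega

lemma mem_interior_iff {N : ℕ} {v : ℤ × ℤ} : v ∈ boxVerts N \ boxBoundary N ↔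
    (1 ≤ v.1 ∧ v.1 + 1 < N) ∧ (1 ≤ v.2 ∧ v.2 + 1 < N) := by
  simp only [boxBoundary, boxVerts, Set.mem_sdiff, Set.mem_ofPred_eq, not_and, not_exists,
    squareLattice]
  constructor
  · rintro ⟨h, h'⟩
    have h1 := h' h (v.1 - 1, v.2) (by simp)
    have h2 := h' h (v.1 + 1, v.2) (by simp)
    have h3 := h' h (v.1, v.2 - 1) (by simp)
    have h4 := h' h (v.1, v.2 + 1) (by simp)
    simp only at h1 h2 h3 h4
    omega
  · intro h
    refine ⟨by omega, fun _ w hw => ?_⟩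
    grind

lemma boxPoint_mem_interior {N : ℕ} (d : Bool × Bool) {x : ℕ × ℕ}
    (hx : x ∈ Finset.Icc 1 (N - 2) ×ˢ Finset.Icc 1 (N - 2)) :
    boxPoint N d x ∈ boxVerts N \ boxBoundary N := by
  simp only [Finset.mem_product, Finset.mem_Icc] at hx
  rw [mem_interior_iff]
  rcases d with ⟨_ | _, _ | _⟩ <;>
    simp only [boxPoint, ofSignedCoord, cond_true, cond_false] <;> omega

lemma boxPoint_mem_bridgeVertices {F : LatticeSubgraph} {N : ℕ} {d : Bool × Bool} {x : ℕ × ℕ}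
    (hx : x ∈ Finset.Icc 1 (N - 2) ×ˢ Finset.Icc 1 (N - 2))
    (hF : F ∈ longPathEvent d x.1 N (boxPoint N d x)) : boxPoint N d x ∈ bridgeVertices F N := by
  obtain ⟨w, u, p, hpF, hp, hv, hk, hR⟩ := hF
  have hint := boxPoint_mem_interior d hx
  refine mem_bridgeVertices_of_isPath p hp hpF hv hint ?_ ?_
  -- The start `w` has coordinate `0` or `N - 1` in the direction `d`, so it is not interior.
  · rw [mem_interior_iff]
    rcases d with ⟨_ | _, _ | _⟩ <;>
      simp only [boxPoint, ofSignedCoord, signedCoord, cond_true, cond_false] at hk ⊢ <;> omega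
  -- Two points of the box differ by at most `N - 1` in each coordinate, so `u` is outside.
  · rw [mem_interior_iff] at hint ⊢
    generalize boxPoint N d x = v at *
    grind

lemma integral_ncard_bridgeVertices (η : Measure LatticeSubgraph) [IsProbabilityMeasure η]
    (N : ℕ) : Integrable (fun F => ((bridgeVertices F N).ncard : ℝ)) η ∧
      ∫ F, ((bridgeVertices F N).ncard : ℝ) ∂η =
        ∑ v ∈ boxFinset N, η.real {F | v ∈ bridgeVertices F N} :=
  integrable_ncard_and_integral_eq _ _ (fun F => bridgeVertices_subset F N)
    (measurableSet_mem_bridgeVertices N)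

lemma sum_longPathEvent_le_integral {η : Measure LatticeSubgraph} [IsProbabilityMeasure η]
    (hη : IsTranslationInvariant η) (N : ℕ) (d : Bool × Bool) :
    (N - 2 : ℕ) * ∑ k ∈ Finset.Icc 1 (N - 2), η.real (longPathEvent d k N 0) ≤
      ∫ F, ((bridgeVertices F N).ncard : ℝ) ∂η := by
  rw [(integral_ncard_bridgeVertices η N).2]
  calc (N - 2 : ℕ) * ∑ k ∈ Finset.Icc 1 (N - 2), η.real (longPathEvent d k N 0)
      = ∑ x ∈ Finset.Icc 1 (N - 2) ×ˢ Finset.Icc 1 (N - 2),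
          η.real (longPathEvent d (x.1 : ℕ) N 0) := by
        rw [Finset.sum_product, Finset.mul_sum]
        simp
    _ ≤ ∑ x ∈ Finset.Icc 1 (N - 2) ×ˢ Finset.Icc 1 (N - 2),
          η.real {F | boxPoint N d x ∈ bridgeVertices F N} :=
        Finset.sum_le_sum fun x hx => (measureReal_longPathEvent_le hη d _ _ 0 _).trans
          (measureReal_mono fun F hF => boxPoint_mem_bridgeVertices hx hF)
    _ = ∑ v ∈ (Finset.Icc 1 (N - 2) ×ˢ Finset.Icc 1 (N - 2)).map
          ⟨boxPoint N d, boxPoint_injective N d⟩, η.real {F | v ∈ bridgeVertices F N} := by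
        rw [Finset.sum_map]
        rfl
    _ ≤ ∑ v ∈ boxFinset N, η.real {F | v ∈ bridgeVertices F N} := by
        refine Finset.sum_le_sum_of_subset_of_nonneg ?_ fun _ _ _ => measureReal_nonneg
        intro v hv
        obtain ⟨x, hx, rfl⟩ := Finset.mem_map.1 hv
        exact mem_boxFinset.2 (boxPoint_mem_interior d hx).1

/-- The factor `6` combines `2k + 1 ≤ 3k` with `N ≤ (N - 1)²`, which compares `log N` to `2 log (N -
1)`. -/
lemma log_le_sum_inv {N : ℕ} (hN : 3 ≤ N) :
    Real.log N / 6 ≤ ∑ k ∈ Finset.Icc 1 (N - 2), (1 : ℝ) / (2 * k + 1) := by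
  have h1 : Real.log (N - 1 : ℕ) ≤ ∑ k ∈ Finset.Icc 1 (N - 2), ((k : ℝ))⁻¹ := by
    have := log_add_one_le_harmonic (N - 2)
    rw [harmonic_eq_sum_Icc] at this
    push_cast at this
    rw [show N - 1 = N - 2 + 1 by omega]
    exact_mod_cast this
  have h2 : Real.log N ≤ 2 * Real.log (N - 1 : ℕ) := by
    rw [← Real.log_rpow (by norm_cast; omega)]
    refine Real.log_le_log (by norm_cast; omega) ?_
    obtain ⟨m, rfl⟩ := Nat.exists_eq_add_of_le hN
    rw [show 3 + m - 1 = m + 2 by omega]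
    norm_num
    nlinarith [(Nat.cast_nonneg m : (0 : ℝ) ≤ m)]
  have h3 : (∑ k ∈ Finset.Icc 1 (N - 2), ((k : ℝ))⁻¹) / 3 ≤
      ∑ k ∈ Finset.Icc 1 (N - 2), (1 : ℝ) / (2 * k + 1) := by
    rw [Finset.sum_div]
    refine Finset.sum_le_sum fun k hk => ?_
    have hk1 : (1 : ℝ) ≤ k := by exact_mod_cast (Finset.mem_Icc.1 hk).1
    rw [inv_eq_one_div, div_div]
    exact one_div_le_one_div_of_le (by positivity) (by linarith)
  linarith

lemma le_integral_of_three_le {η : Measure LatticeSubgraph} [IsProbabilityMeasure η]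
    (hη : IsTranslationInvariant η) (hF : ∀ᵐ F ∂η, IsSingleInfiniteForest F) {N : ℕ}
    (hN : 3 ≤ N) : 1 / 72 * η.real {F | 0 ∈ F.verts} * (N * Real.log N) ≤
      ∫ F, ((bridgeVertices F N).ncard : ℝ) ∂η := by
  set p := η.real {F | (0 : ℤ × ℤ) ∈ F.verts}
  have hp : 0 ≤ p := measureReal_nonneg
  have h1 : (N - 2 : ℕ) * ∑ k ∈ Finset.Icc 1 (N - 2), p * (1 / (2 * k + 1)) ≤
      4 * ∫ F, ((bridgeVertices F N).ncard : ℝ) ∂η := by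
    calc (N - 2 : ℕ) * ∑ k ∈ Finset.Icc 1 (N - 2), p * (1 / (2 * (k : ℝ) + 1))
        ≤ (N - 2 : ℕ) * ∑ k ∈ Finset.Icc 1 (N - 2), ∑ d : Bool × Bool,
            η.real (longPathEvent d k N 0) := by
          refine mul_le_mul_of_nonneg_left (Finset.sum_le_sum fun k _ => ?_) (Nat.cast_nonneg _)
          rw [mul_one_div, div_le_iff₀' (by positivity)]
          exact measureReal_mem_verts_le_sum hη hF k (Int.natCast_nonneg N)
      _ = ∑ d : Bool × Bool, (N - 2 : ℕ) * ∑ k ∈ Finset.Icc 1 (N - 2),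
            η.real (longPathEvent d k N 0) := by
          rw [Finset.sum_comm, Finset.mul_sum]
      _ ≤ ∑ _d : Bool × Bool, ∫ F, ((bridgeVertices F N).ncard : ℝ) ∂η :=
          Finset.sum_le_sum fun d _ => sum_longPathEvent_le_integral hη N d
      _ = _ := by simp
  rw [← Finset.mul_sum] at h1
  have h2 : (N : ℝ) / 3 ≤ (N - 2 : ℕ) := by
    rw [div_le_iff₀ (by norm_num)]
    norm_cast
    omega
  have h3 : 0 ≤ Real.log N := Real.log_natCast_nonneg N
  have h4 : (N : ℝ) / 3 * (p * (Real.log N / 6)) ≤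
      (N - 2 : ℕ) * (p * ∑ k ∈ Finset.Icc 1 (N - 2), (1 : ℝ) / (2 * k + 1)) :=
    mul_le_mul h2 (mul_le_mul_of_nonneg_left (log_le_sum_inv hN) hp) (by positivity)
      (Nat.cast_nonneg _)
  -- The constant is `72 = 3 · 6 · 4`: from `N - 2 ≥ N / 3`, the harmonic sum, and the four
  -- directions.
  linarith

/-! ### The box of side two, where every vertex is on the boundary and every edge is a bridge -/

lemma mem_bridgeVertices_of_adj {F : LatticeSubgraph} {v w : ℤ × ℤ} (h : F.Adj v w)
    (hv : v ∈ boxVerts 2) (hw : w ∈ boxVerts 2) : v ∈ bridgeVertices F 2 := by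
  have hbd : ∀ x ∈ boxVerts 2, x ∈ boxBoundary 2 := by
    intro x hx
    by_contra hc
    have := mem_interior_iff.1 ⟨hx, hc⟩
    push_cast at this
    omega
  have hl : squareLattice.Adj v w := F.adj_sub h
  refine ⟨v, w, .cons hl .nil, ⟨?_, by simp, le_inf ?_ (toSubgraph_le_box _ ?_), hbd v hv,
    hbd w hw⟩, by simp⟩
  · simp [Walk.cons_isPath_iff, hl.ne]
  · exact sup_le (subgraphOfAdj_le_of_adj F h) (by simpa using F.edge_vert h.symm)
  · intro x hx
    simp only [Walk.support_cons, Walk.support_nil, List.mem_cons, List.not_mem_nil,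
      or_false] at hx
    rcases hx with rfl | rfl
    exacts [hv, hw]

lemma exists_adj_of_mem_verts {F : LatticeSubgraph} (hF : IsSingleInfiniteForest F) {v : ℤ × ℤ}
    (hv : v ∈ F.verts) : ∃ w, F.Adj v w := by
  obtain ⟨u, p, -, hpF, hu⟩ := exists_isPath_of_isSingleInfiniteForest hF hv 1
  cases p with
  | nil => simp at hu
  | @cons _ w _ h q => exact ⟨w, hpF.2 (by simp)⟩

lemma measureReal_adj_le_integral {η : Measure LatticeSubgraph} [IsProbabilityMeasure η]
    (hη : IsTranslationInvariant η) (d : Bool × Bool) :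
    η.real {F | F.Adj 0 (ofSignedCoord d 1 0)} ≤
      ∫ F, ((bridgeVertices F 2).ncard : ℝ) ∂η := by
  rw [(integral_ncard_bridgeVertices η 2).2]
  obtain ⟨a, ha, hb⟩ : ∃ a : ℤ × ℤ, 0 + a ∈ boxVerts 2 ∧ ofSignedCoord d 1 0 + a ∈ boxVerts 2 := by
    -- Edges from the origin in a positive direction already lie in the box; the others do after a
    -- shift by `(1, 1)`.
    refine ⟨bif d.2 then 0 else (1, 1), ?_⟩
    rcases d with ⟨_ | _, _ | _⟩ <;> simp [boxVerts, ofSignedCoord]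
  calc _ ≤ η.real {F | F.Adj (0 + a) (ofSignedCoord d 1 0 + a)} :=
        measureReal_adj_le_of_invariant hη _ _ a
    _ ≤ η.real {F | 0 + a ∈ bridgeVertices F 2} :=
        measureReal_mono fun F hF => mem_bridgeVertices_of_adj hF ha hb
    _ ≤ _ := Finset.single_le_sum (f := fun v => η.real {F | v ∈ bridgeVertices F 2})
        (fun _ _ => measureReal_nonneg) (mem_boxFinset.2 ha)

lemma measureReal_mem_verts_le_integral_two {η : Measure LatticeSubgraph}
    [IsProbabilityMeasure η] (hη : IsTranslationInvariant η)
    (hF : ∀ᵐ F ∂η, IsSingleInfiniteForest F) :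
    η.real {F | 0 ∈ F.verts} ≤ 4 * ∫ F, ((bridgeVertices F 2).ncard : ℝ) ∂η := by
  calc η.real {F | 0 ∈ F.verts}
      ≤ η.real (⋃ d ∈ (Finset.univ : Finset (Bool × Bool)),
          {F | F.Adj 0 (ofSignedCoord d 1 0)}) := by
        refine ENNReal.toReal_mono (measure_ne_top _ _) (measure_mono_ae ?_)
        filter_upwards [hF] with F hF h0
        obtain ⟨w, hw⟩ := exists_adj_of_mem_verts hF h0
        have hl : |0 - w.1| + |0 - w.2| = 1 := F.adj_sub hw
        obtain ⟨d, rfl⟩ : ∃ d, w = ofSignedCoord d 1 0 := by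
          have : (w.1 = 1 ∧ w.2 = 0) ∨ (w.1 = -1 ∧ w.2 = 0) ∨ (w.1 = 0 ∧ w.2 = 1) ∨
              (w.1 = 0 ∧ w.2 = -1) := by grind
          rcases this with h | h | h | h
          · exact ⟨(true, true), Prod.ext h.1 h.2⟩
          · exact ⟨(true, false), Prod.ext h.1 h.2⟩
          · exact ⟨(false, true), Prod.ext h.1 h.2⟩
          · exact ⟨(false, false), Prod.ext h.1 h.2⟩
        exact Set.mem_biUnion (Finset.mem_univ d) hw
    _ ≤ ∑ d : Bool × Bool, η.real {F | F.Adj 0 (ofSignedCoord d 1 0)} :=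
        measureReal_biUnion_finset_le _ _
    _ ≤ ∑ _d : Bool × Bool, ∫ F, ((bridgeVertices F 2).ncard : ℝ) ∂η :=
        Finset.sum_le_sum fun d _ => measureReal_adj_le_integral hη d
    _ = _ := by simp

lemma le_integral_ncard_bridgeVertices {η : Measure LatticeSubgraph} [IsProbabilityMeasure η]
    (hη : IsTranslationInvariant η) (hF : ∀ᵐ F ∂η, IsSingleInfiniteForest F) (v : ℤ × ℤ)
    (N : ℕ) : 1 / 72 * η.real {F | v ∈ F.verts} * (N * Real.log N) ≤
      ∫ F, ((bridgeVertices F N).ncard : ℝ) ∂η := by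
  have hlog : (0 : ℝ) ≤ N * Real.log N :=
    mul_nonneg (Nat.cast_nonneg _) (Real.log_natCast_nonneg N)
  have hle : 1 / 72 * η.real {F | v ∈ F.verts} * (N * Real.log N) ≤
      1 / 72 * η.real {F | 0 ∈ F.verts} * (N * Real.log N) := by
    have := measureReal_mem_verts_le_of_invariant hη v 0
    gcongr
  refine hle.trans ?_
  have hnn : ∀ n, 0 ≤ ∫ F, ((bridgeVertices F n).ncard : ℝ) ∂η :=
    fun n => integral_nonneg fun F => Nat.cast_nonneg _
  rcases le_or_gt 3 N with h3 | h3
  · exact le_integral_of_three_le hη hF h3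
  -- For `N = 0` and `N = 1` the left side vanishes; `N = 2` uses the single-edge bridges.
  · interval_cases N
    · simpa using hnn 0
    · simpa using hnn 1
    · have h2 := measureReal_mem_verts_le_integral_two hη hF
      have hl : Real.log 2 < 1 := Real.log_two_lt_d9.trans (by norm_num)
      have hp : 0 ≤ η.real {F | (0 : ℤ × ℤ) ∈ F.verts} := measureReal_nonneg
      push_cast
      nlinarith [hnn 2]

lemma integral_ncard_bridgeVertices_le (η : Measure LatticeSubgraph) [IsProbabilityMeasure η]
    (N : ℕ) : ∫ F, ((bridgeVertices F N).ncard : ℝ) ∂η ≤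
      2 * ∫ F, ((bridgeEdges F N).ncard : ℝ) ∂η := by
  rw [← integral_const_mul]
  refine integral_mono (integral_ncard_bridgeVertices η N).1 (Integrable.const_mul ?_ _) ?_
  · exact (integrable_ncard_and_integral_eq _ _ (fun F => bridgeEdges_subset F N)
      (measurableSet_mem_bridgeEdges N)).1
  · intro F
    beta_reduce
    exact_mod_cast ncard_bridgeVertices_le F N

end LatticeSubgraph

theorem mainTheorem4 :
    ∃ C' : ℝ, 0 < C' ∧
      ∀ η : Measure LatticeSubgraph, IsProbabilityMeasure η → IsTranslationInvariant η →
        (∀ᵐ F ∂η, IsSingleInfiniteForest F) →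
        (∀ (v : ℤ × ℤ) (N : ℕ),
          C' * η.real {F | v ∈ F.verts} * (N * Real.log N) ≤
            ∫ F, ((bridgeVertices F N).ncard : ℝ) ∂η) ∧
        (∀ e ∈ squareLattice.edgeSet, ∀ N : ℕ,
          C' * η.real {F | e ∈ F.edgeSet} * (N * Real.log N) ≤
            ∫ F, ((bridgeEdges F N).ncard : ℝ) ∂η) := by
  -- Half of `1 / 72`, the loss coming from counting edges instead of vertices.
  refine ⟨1 / 144, by norm_num, fun η _ hη hF => ⟨fun v N => ?_, fun e _ N => ?_⟩⟩
  · have h := LatticeSubgraph.le_integral_ncard_bridgeVertices hη hF v N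
    have h0 : 0 ≤ ∫ F, ((bridgeVertices F N).ncard : ℝ) ∂η :=
      integral_nonneg fun F => Nat.cast_nonneg _
    linarith
  · induction e with
    | _ v w =>
      have h := LatticeSubgraph.le_integral_ncard_bridgeVertices hη hF v N
      have h' := LatticeSubgraph.integral_ncard_bridgeVertices_le η N
      have hle : η.real {F | s(v, w) ∈ F.edgeSet} ≤ η.real {F | v ∈ F.verts} :=
        measureReal_mono fun F hF => F.edge_vert hF
      have := mul_le_mul_of_nonneg_right hle
        (mul_nonneg (Nat.cast_nonneg N) (Real.log_natCast_nonneg N))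
      linarith
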